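/- Let $n\ge 1$ and write $[m]=\{1,\dots,m\}$. Let $S_n^C$ be the subgroup of $S_{2n}$ of all permutations $\tau$ with $\tau(2n+1-a)=2n+1-\tau(a)$ for all $a\in[2n]$, i.e. the Weyl group of type $C_n$, with simple reflections $s_is_{2n-i}$ ($1\le i\le n-1$) and $s_n$, where $s_i$ is the transposition $(i,i+1)$; let $\ell^C$ be its length function and let $(S_n^C)_n=S_n^C\cap(S_n\times S_n)$ be the subgroup of those elements that preserve $[n]$. Let $\le_n^C$ be the reflexive transitive closure of the relations $u\lessdot w$ (covering relations of the strong Bruhat order of $S_n^C$) with $u(S_n^C)_n\ne w(S_n^C)_n$. Let $\mathcal Q^C(2n)$ be the set of classes $\langle u,w\rangle_n^C$ of intervals $[u,w]$ with $u\le_n^C w$, for the equivalence relation generated by $[u,w]\sim[uz,wz]$ (both being such intervals) whenever $z\in(S_n^C)_n$, $\ell^C(uz)=\ell^C(u)+\ell^C(z)$ and $\ell^C(wz)=\ell^C(w)+\ell^C(z)$. An affine permutation of order $2n$ is a bijection $f:\mathbb Z\to\mathbb Z$ with $f(i+2n)=f(i)+2n$ for all $i$. Let $\mathrm{Bd}(n,2n)$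 be the set of bounded affine permutations of type $(n,2n)$: those with $i\le f(i)\le i+2n$ for all $i\in\mathbb Z$ and $\frac1{2n}\sum_{i=1}^{2n}(f(i)-i)=n$. Extend elements of $S_{2n}$ to $\mathbb Z$ periodically with period $2n$, and let $t_{[n]}$ be the affine permutation with $t_{[n]}(i)=i+2n$ for $1\le i\le n$ and $t_{[n]}(i)=i$ for $n<i\le 2n$. Let the set $\mathrm{Bd}^C(2n)$ of type C bounded affine permutations be the image of $\mathcal Q^C(2n)$ under the well-defined map $\langle u,w\rangle_n^C\mapsto u\,t_{[n]}\,w^{-1}$. Then $\mathrm{Bd}^C(2n)$ consists of exactly those $f\in \mathrm{Bd}(n,2n)$ which satisfy \[ f(2n+1-a)=4n+1-f(a)\qquad\text{for all } a\in[2n]. \] -/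

import Mathlib

/-!
Bruhat order, parabolic Bruhat order and the set of classes of parabolic Bruhat intervals for a
group with a distinguished set of involutive generators; the Weyl groups of types A and C;
affine permutations, bounded affine permutations and their type C analogues.
-/

namespace BoundedAffine

section Weyl

variable {W : Type*} [Group W]

/-- The length of `w` with respect to the generating set `S` of simple reflections: the least
number of factors in an expression of `w` as a product of elements of `S`. -/
noncomputable def length (S : Set W) (w : W) : ℕ :=
  sInf {m | ∃ l : List W, l.length = m ∧ (∀ s ∈ l, s ∈ S) ∧ l.prod = w}

/-- Reflections: conjugates of simple reflections. -/
def IsReflection (S : Set W) (t : W) : Prop :=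
  ∃ x : W, ∃ s ∈ S, t = x * s * x⁻¹

/-- The (strong) Bruhat order: the reflexive transitive closure of the relations `u → u t`, where
`t` is a reflection and `u t` is longer than `u`. -/
def BruhatLE (S : Set W) : W → W → Prop :=
  Relation.ReflTransGen fun u w =>
    ∃ t, IsReflection S t ∧ w = u * t ∧ length S u < length S w

/-- The covering relation `u ⋖ w` of the Bruhat order. -/
def BruhatCovBy (S : Set W) (u w : W) : Prop :=
  BruhatLE S u w ∧ u ≠ w ∧ ∀ v, BruhatLE S u v → BruhatLE S v w → v = u ∨ v = w

/-- The `P`-Bruhat order of the subgroup `WP`: the reflexive transitive closure of the relations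
`u ⋖ w` in Bruhat order with `u WP ≠ w WP` as left cosets. -/
def PBruhatLE (S : Set W) (WP : Subgroup W) : W → W → Prop :=
  Relation.ReflTransGen fun u w => BruhatCovBy S u w ∧ (u : W ⧸ WP) ≠ (w : W ⧸ WP)

/-- The `P`-Bruhat intervals `[u, w]_P`, recorded by their end points `u ≤_P w`. -/
def PInterval (S : Set W) (WP : Subgroup W) : Type _ :=
  {p : W × W // PBruhatLE S WP p.1 p.2}

/-- The generating relation on `P`-Bruhat intervals: `[x, y]_P` is related to `[u, w]_P` if there
is `z ∈ WP` with `x = u z` and `y = w z`, both factorizations being length-additive. -/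
def PInterval.Rel (S : Set W) (WP : Subgroup W) (I J : PInterval S WP) : Prop :=
  ∃ z ∈ WP,
    J.1.1 = I.1.1 * z ∧ length S (I.1.1 * z) = length S I.1.1 + length S z ∧
    J.1.2 = I.1.2 * z ∧ length S (I.1.2 * z) = length S I.1.2 + length S z

/-- The set `𝒬(W, WP)` of equivalence classes `⟨u, w⟩_P` of `P`-Bruhat intervals, for the
equivalence relation generated by `PInterval.Rel`. -/
def QPoset (S : Set W) (WP : Subgroup W) : Type _ :=
  Quot (PInterval.Rel S WP)

end Weyl

/-! ### Weyl groups of types A and C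

The set `{1, …, m}` is modelled by `Fin m`, the number `i + 1` corresponding to `i : Fin m`; the
map `a ↦ m + 1 - a` is then `Fin.rev`. -/

/-- The adjacent transpositions of `S_m`. -/
def simpleA (m : ℕ) : Set (Equiv.Perm (Fin m)) :=
  {τ | ∃ i j : Fin m, i.val + 1 = j.val ∧ τ = Equiv.swap i j}

/-- The Young subgroup `S_k × S_{m-k}` of `S_m`: the permutations which preserve the set of the
first `k` letters (and hence its complement). -/
def young (k m : ℕ) : Subgroup (Equiv.Perm (Fin m)) where
  carrier := {σ | ∀ i, (σ i).val < k ↔ i.val < k}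
  one_mem' := fun _ => Iff.rfl
  mul_mem' := fun {a b} ha hb i => (ha (b i)).trans (hb i)
  inv_mem' := fun {a} ha i => by
    have h := ha (a⁻¹ i)
    have e : a (a⁻¹ i) = i := a.apply_symm_apply i
    rw [e] at h
    exact h.symm

/-- The Weyl group `S_n^C` of type `C_n`: the permutations `τ ∈ S_{2n}` with
`τ (2n + 1 - a) = 2n + 1 - τ a`. -/
def weylC (n : ℕ) : Subgroup (Equiv.Perm (Fin (2 * n))) where
  carrier := {τ | ∀ a, τ a.rev = (τ a).rev}
  one_mem' := fun _ => rfl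
  mul_mem' := fun {a b} ha hb i => by
    rw [Equiv.Perm.mul_apply, Equiv.Perm.mul_apply, hb i, ha (b i)]
  inv_mem' := fun {a} ha i => by
    have e : a (a⁻¹ i) = i := a.apply_symm_apply i
    rw [Equiv.Perm.inv_eq_iff_eq, ha, e]

/-- The simple reflections of `S_n^C`: `s_i s_{2n-i}` for `1 ≤ i ≤ n - 1`, and `s_n`, where `s_i`
is the transposition of `i` and `i + 1`. -/
def simpleC (n : ℕ) : Set (weylC n) :=
  {τ | ∃ i j : Fin (2 * n), i.val + 1 = j.val ∧
    ((j.val < n ∧ τ.1 = Equiv.swap i j * Equiv.swap j.rev i.rev) ∨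
      (j.val = n ∧ τ.1 = Equiv.swap i j))}

/-- The parabolic subgroup `(S_n^C)_n`: the elements of `S_n^C` which lie in `S_n × S_n`. -/
def parabolicC (n : ℕ) : Subgroup (weylC n) :=
  (young n (2 * n)).subgroupOf (weylC n)

/-- `𝒬(k, m)`, for `W = S_m` and `W_P = S_k × S_{m-k}`. -/
abbrev QA (k m : ℕ) : Type := QPoset (simpleA m) (young k m)

/-- `𝒬^C(2n)`, for `W = S_n^C` and `W_P = (S_n^C)_n`. -/
abbrev QC (n : ℕ) : Type := QPoset (simpleC n) (parabolicC n)

/-! ### Affine permutations -/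

/-- The group of affine permutations of order `m`: bijections `f : ℤ → ℤ` with
`f (i + m) = f i + m`. -/
def AffinePerm (m : ℕ) : Subgroup (Equiv.Perm ℤ) where
  carrier := {f | ∀ i : ℤ, f (i + m) = f i + m}
  one_mem' := fun _ => rfl
  mul_mem' := fun {a b} ha hb i => by
    rw [Equiv.Perm.mul_apply, Equiv.Perm.mul_apply, hb i, ha (b i)]
  inv_mem' := fun {a} ha i => by
    have e : a (a⁻¹ i) = i := a.apply_symm_apply i
    rw [Equiv.Perm.inv_eq_iff_eq, ha, e]

/-- The set `Bd(k, m)` of bounded affine permutations of type `(k, m)`. -/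
def Bd (k m : ℕ) : Set (AffinePerm m) :=
  {f | (∑ i ∈ Finset.Icc (1 : ℤ) m, (f.1 i - i) = (m : ℤ) * k) ∧
    ∀ i : ℤ, i ≤ f.1 i ∧ f.1 i ≤ i + m}

/-- Every integer is uniquely of the form `(r + 1) + q m` with `q ∈ ℤ`, `r ∈ {0, …, m - 1}`;
this is the bijection `(r + 1) + q m ↦ (q, r)`. -/
def residue (m : ℕ) [NeZero m] : ℤ ≃ ℤ × Fin m :=
  (Equiv.subRight 1).trans (Int.divModEquiv m)

theorem residue_symm_apply (m : ℕ) [NeZero m] (q : ℤ) (r : Fin m) :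
    (residue m).symm (q, r) = (r.val + 1 : ℤ) + q * m := by
  simp [residue, Int.divModEquiv]
  ring

theorem residue_add (m : ℕ) [NeZero m] (i : ℤ) :
    residue m (i + m) = ((residue m i).1 + 1, (residue m i).2) := by
  rw [← Equiv.eq_symm_apply, residue_symm_apply]
  have h := residue_symm_apply m (residue m i).1 (residue m i).2
  rw [Prod.mk.eta, Equiv.symm_apply_apply] at h
  rw [add_mul, one_mul, ← add_assoc, ← h]

/-- The affine permutation of order `m` given on `ℤ ≅ ℤ × Fin m` by a permutation `w` of
residues together with a translation vector `c`: it maps `(r + 1) + q m` to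
`(w r + 1) + (q + c r) m`. -/
def ofResidue (m : ℕ) [NeZero m] (w : Equiv.Perm (Fin m)) (c : Fin m → ℤ) : AffinePerm m :=
  ⟨((residue m).trans
      { toFun := fun p => (p.1 + c p.2, w p.2)
        invFun := fun p => (p.1 - c (w.symm p.2), w.symm p.2)
        left_inv := fun p => by simp
        right_inv := fun p => by simp }).trans (residue m).symm, fun i => by
    simp only [Equiv.trans_apply, residue_add, Equiv.coe_fn_mk, residue_symm_apply]
    ring⟩

theorem ofResidue_apply (m : ℕ) [NeZero m] (w : Equiv.Perm (Fin m)) (c : Fin m → ℤ)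
    (q : ℤ) (r : Fin m) :
    (ofResidue m w c).1 ((r.val + 1 : ℤ) + q * m) = ((w r).val + 1 : ℤ) + (q + c r) * m := by
  rw [← residue_symm_apply m q r, ← residue_symm_apply m (q + c r) (w r)]
  simp [ofResidue]

/-- A permutation of `{1, …, m}`, extended periodically to `ℤ`. -/
def extend (m : ℕ) [NeZero m] (w : Equiv.Perm (Fin m)) : AffinePerm m :=
  ofResidue m w 0

/-- The translation element `t_{[k]}`: `i ↦ i + m` for `1 ≤ i ≤ k` and `i ↦ i` for
`k < i ≤ m`, extended periodically. -/
def translation (k m : ℕ) [NeZero m] : AffinePerm m :=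
  ofResidue m 1 fun r => if r.val < k then 1 else 0

/-- The affine permutation `f_{u,w} = u t_{[k]} w⁻¹`. -/
def fPerm (k m : ℕ) [NeZero m] (u w : Equiv.Perm (Fin m)) : AffinePerm m :=
  extend m u * translation k m * (extend m w)⁻¹

theorem ofResidue_mul (m : ℕ) [NeZero m] (w w' : Equiv.Perm (Fin m)) (c c' : Fin m → ℤ) :
    ofResidue m w c * ofResidue m w' c' = ofResidue m (w * w') fun r => c' r + c (w' r) := by
  ext i
  simp [ofResidue, add_assoc]

theorem fPerm_mul_young (k m : ℕ) [NeZero m] (u w z : Equiv.Perm (Fin m)) (hz : z ∈ young k m) :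
    fPerm k m (u * z) (w * z) = fPerm k m u w := by
  have hmul : ∀ a b : Equiv.Perm (Fin m), extend m (a * b) = extend m a * extend m b := by
    intro a b
    rw [extend, extend, extend, ofResidue_mul]
    congr 1
  have hcomm : extend m z * translation k m = translation k m * extend m z := by
    rw [extend, translation, ofResidue_mul, ofResidue_mul, mul_one, one_mul]
    congr 1
    funext r
    simp only [Pi.zero_apply, add_zero, zero_add]
    exact if_congr (hz r).symm rfl rfl
  rw [fPerm, fPerm, hmul, hmul, mul_assoc (extend m u), hcomm]
  group

/-- The map `⟨u, w⟩_k ↦ f_{u,w}` on `𝒬(k, m)`. -/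
def QA.toAffine (k m : ℕ) [NeZero m] : QA k m → AffinePerm m :=
  Quot.lift (fun I => fPerm k m I.1.1 I.1.2) (by
    rintro I J ⟨z, hz, h₁, -, h₂, -⟩
    simp only [h₁, h₂]
    exact (fPerm_mul_young k m _ _ z hz).symm)

/-- The restriction of the map `⟨u, w⟩_n ↦ f_{u,w}` on `𝒬(n, 2n)` to `𝒬^C(2n)`, that is, the map
`⟨u, w⟩_n^C ↦ ⟨u, w⟩_n ↦ f_{u,w}`, where `S_n^C` is viewed as a subgroup of `S_{2n}`. -/
def QC.toAffine (n : ℕ) [NeZero n] : QC n → AffinePerm (2 * n) :=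
  Quot.lift (fun I => fPerm n (2 * n) I.1.1.1 I.1.2.1) (by
    rintro I J ⟨z, hz, h₁, -, h₂, -⟩
    simp only [h₁, h₂]
    exact (fPerm_mul_young n (2 * n) _ _ z.1 hz).symm)

/-- The two maps agree on `⟨u, w⟩_n^C` and `⟨u, w⟩_n`. -/
theorem QC.toAffine_eq_QA (n : ℕ) [NeZero n] (I : PInterval (simpleC n) (parabolicC n))
    (h : PBruhatLE (simpleA (2 * n)) (young n (2 * n)) I.1.1.1 I.1.2.1) :
    QC.toAffine n (Quot.mk _ I) =
      QA.toAffine n (2 * n) (Quot.mk _ ⟨(I.1.1.1, I.1.2.1), h⟩) :=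
  rfl

/-- The set `Bd^C(2n)` of type C bounded affine permutations: the image of `𝒬^C(2n)` under
`⟨u, w⟩ ↦ f_{u,w}`. -/
def BdC (n : ℕ) [NeZero n] : Set (AffinePerm (2 * n)) :=
  Set.range (QC.toAffine n)

end BoundedAffine

/-! Everything reduces to a pointwise description of the parabolic order. The permutation `f = fPerm
n (2 * n) u w` sends the letter `w c` to `u c`, shifted by `2n` exactly when `c` is one of the first
`n` positions. So `f` is bounded as soon as `u c ≤ w c` on the first half and `w c ≤ u c` on the
second half; for `u`, `w` in `weylC n` the second condition is the mirror image of the first. The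
symmetry of `f` holds because `Fin.rev` swaps the halves: exactly one of two mirror letters is
shifted.

If `u` is below `w` in the parabolic order, the inequality on the first half holds because each
cover exchanges values across the middle and raises those on the left (`PBruhatLE.apply_le`). The
converse is needed only when `w` is increasing on the first half (`pBruhatLE_of_apply_le`). In that
case `exists_pBruhat_step` finds a cover of `u` across the middle that is still pointwise below `w`,
and finiteness ends the chain.

Given a symmetric bounded `f`, let `s` be its residue permutation and `I` the set of letters with
value above `2n`. By symmetry `I` contains one letter of each mirror pair, so some `w` in `weylC n`
maps the first half increasingly onto `I`. Then `u = s * w` works, since boundedness says precisely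
`u c ≤ w c` on the first half.

Covers are recognised by length: twice the type C length is the number of inversions plus the number
of first-half positions with second-half values (`two_mul_length`), and these counts are tracked
through transpositions. -/

namespace BoundedAffine

open Equiv

/-! ### Inversion statistics under transpositions -/

/-- The number of inversions of a permutation, as an integer. -/
def invCount {m : ℕ} (u : Perm (Fin m)) : ℤ :=
  ∑ p, ∑ q, if p < q ∧ u q < u p then 1 else 0

/-- The number of positions below `k` whose value is at least `k`. -/
def crossCount (k : ℕ) {m : ℕ} (u : Perm (Fin m)) : ℤ :=
  ∑ c, if c.val < k ∧ k ≤ (u c).val then 1 else 0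

/-- The number of positions strictly between `a` and `b` whose value is strictly between `u a` and
`u b`. -/
def betweenCount {m : ℕ} (u : Perm (Fin m)) (a b : Fin m) : ℤ :=
  ∑ c, if a < c ∧ c < b ∧ u a < u c ∧ u c < u b then 1 else 0

theorem sum_univ_eq_add_add_sum_compl {α : Type*} [Fintype α] [DecidableEq α] {a b : α}
    (hab : a ≠ b) (f : α → ℤ) :
    ∑ c, f c = f a + f b + ∑ c ∈ ({a, b} : Finset α)ᶜ, f c := by
  rw [← Finset.sum_add_sum_compl {a, b}, Finset.sum_pair hab]

theorem sum_sum_univ_split {α : Type*} [Fintype α] [DecidableEq α] {a b : α}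
    (hab : a ≠ b) (F : α → α → ℤ) :
    ∑ p, ∑ q, F p q = F a a + F a b + F b a + F b b +
      ∑ c ∈ ({a, b} : Finset α)ᶜ, (F a c + F c a + F b c + F c b) +
      ∑ p ∈ ({a, b} : Finset α)ᶜ, ∑ q ∈ ({a, b} : Finset α)ᶜ, F p q := by
  simp only [sum_univ_eq_add_add_sum_compl hab, Finset.sum_add_distrib]
  ring

/-- Here `x`, `y`, `z` play the roles of `u a`, `u b`, `u c`. A third position contributes equally
before and after the exchange unless it lies between the two both in position and in value, and then
it creates two inversions. -/
theorem inversion_terms_swap {m : ℕ} {a b c x y z : Fin m} (hab : a < b) (hxy : x < y)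
    (hca : c ≠ a) (hcb : c ≠ b) (hzx : z ≠ x) (hzy : z ≠ y) :
    ((if a < c ∧ z < y then 1 else 0) + (if c < a ∧ y < z then 1 else 0) +
      (if b < c ∧ z < x then 1 else 0) + (if c < b ∧ x < z then 1 else 0) : ℤ) =
    ((if a < c ∧ z < x then 1 else 0) + (if c < a ∧ x < z then 1 else 0) +
      (if b < c ∧ z < y then 1 else 0) + (if c < b ∧ y < z then 1 else 0)) +
      2 * (if a < c ∧ c < b ∧ x < z ∧ z < y then 1 else 0) := by
  have h1 : c < a ∨ (a < c ∧ c < b) ∨ b < c := by omega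
  have h2 : z < x ∨ (x < z ∧ z < y) ∨ y < z := by omega
  rcases h1 with h1 | ⟨h1, h1'⟩ | h1 <;> rcases h2 with h2 | ⟨h2, h2'⟩ | h2 <;>
    simp [*, h1.trans, h2.trans, hab.trans, hxy.trans, lt_asymm]

theorem invCount_mul_swap {m : ℕ} (u : Perm (Fin m)) {a b : Fin m} (hab : a < b)
    (hu : u a < u b) :
    invCount (u * swap a b) = invCount u + 1 + 2 * betweenCount u a b := by
  have hc : ∀ c ∈ ({a, b} : Finset (Fin m))ᶜ, c ≠ a ∧ c ≠ b := by simp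
  rw [invCount, invCount, betweenCount, sum_sum_univ_split hab.ne, sum_sum_univ_split hab.ne,
    sum_univ_eq_add_add_sum_compl hab.ne]
  have e1 : ∑ p ∈ ({a, b} : Finset (Fin m))ᶜ, ∑ q ∈ ({a, b} : Finset (Fin m))ᶜ,
      (if p < q ∧ (u * swap a b) q < (u * swap a b) p then (1 : ℤ) else 0) =
      ∑ p ∈ ({a, b} : Finset (Fin m))ᶜ, ∑ q ∈ ({a, b} : Finset (Fin m))ᶜ,
      (if p < q ∧ u q < u p then (1 : ℤ) else 0) := by
    refine Finset.sum_congr rfl fun p hp => Finset.sum_congr rfl fun q hq => ?_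
    simp only [Perm.mul_apply, swap_apply_of_ne_of_ne (hc p hp).1 (hc p hp).2,
      swap_apply_of_ne_of_ne (hc q hq).1 (hc q hq).2]
  have e2 := Finset.sum_congr (rfl : ({a, b} : Finset (Fin m))ᶜ = _) fun c h =>
    inversion_terms_swap hab hu (hc c h).1 (hc c h).2 (u.injective.ne (hc c h).1)
      (u.injective.ne (hc c h).2)
  have e3 : ∑ c ∈ ({a, b} : Finset (Fin m))ᶜ,
      ((if a < c ∧ (u * swap a b) c < (u * swap a b) a then (1 : ℤ) else 0) +
      (if c < a ∧ (u * swap a b) a < (u * swap a b) c then 1 else 0) +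
      (if b < c ∧ (u * swap a b) c < (u * swap a b) b then 1 else 0) +
      (if c < b ∧ (u * swap a b) b < (u * swap a b) c then 1 else 0)) =
      ∑ c ∈ ({a, b} : Finset (Fin m))ᶜ,
      ((if a < c ∧ u c < u b then (1 : ℤ) else 0) + (if c < a ∧ u b < u c then 1 else 0) +
      (if b < c ∧ u c < u a then 1 else 0) + (if c < b ∧ u a < u c then 1 else 0)) := by
    refine Finset.sum_congr rfl fun c h => ?_
    simp only [Perm.mul_apply, swap_apply_of_ne_of_ne (hc c h).1 (hc c h).2, swap_apply_left,
      swap_apply_right]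
  rw [e1, e3, e2, Finset.sum_add_distrib, ← Finset.mul_sum]
  simp [hab, hu, hab.not_gt, hu.not_gt]
  ring

theorem crossCount_mul_swap (k : ℕ) {m : ℕ} (u : Perm (Fin m)) {a b : Fin m} (hab : a < b)
    (hu : u a < u b) :
    crossCount k (u * swap a b) = crossCount k u +
      if a.val < k ∧ k ≤ b.val ∧ (u a).val < k ∧ k ≤ (u b).val then 1 else 0 := by
  have e : ∑ c ∈ ({a, b} : Finset (Fin m))ᶜ,
      (if c.val < k ∧ k ≤ ((u * swap a b) c).val then (1 : ℤ) else 0) =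
      ∑ c ∈ ({a, b} : Finset (Fin m))ᶜ, (if c.val < k ∧ k ≤ (u c).val then (1 : ℤ) else 0) := by
    refine Finset.sum_congr rfl fun c h => ?_
    have h : c ≠ a ∧ c ≠ b := by simpa using h
    rw [Perm.mul_apply, swap_apply_of_ne_of_ne h.1 h.2]
  rw [crossCount, crossCount, sum_univ_eq_add_add_sum_compl hab.ne,
    sum_univ_eq_add_add_sum_compl hab.ne, e]
  simp only [Perm.mul_apply, swap_apply_left, swap_apply_right]
  have h1 : a.val < b.val := hab
  have h2 : (u a).val < (u b).val := hu
  split_ifs <;> omega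

/-- Twice the length of an element of the Weyl group of type C. -/
def doubleLength {n : ℕ} (u : Perm (Fin (2 * n))) : ℤ :=
  invCount u + crossCount n u

theorem doubleLength_mul_swap {n : ℕ} (u : Perm (Fin (2 * n))) {a b : Fin (2 * n)} (hab : a < b)
    (hu : u a < u b) :
    doubleLength (u * swap a b) = doubleLength u + 1 + 2 * betweenCount u a b +
      if a.val < n ∧ n ≤ b.val ∧ (u a).val < n ∧ n ≤ (u b).val then 1 else 0 := by
  rw [doubleLength, doubleLength, invCount_mul_swap u hab hu, crossCount_mul_swap n u hab hu]
  ring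

theorem betweenCount_nonneg {m : ℕ} (u : Perm (Fin m)) (a b : Fin m) :
    0 ≤ betweenCount u a b :=
  Finset.sum_nonneg fun _ _ => by split_ifs <;> simp

theorem betweenCount_eq_zero {m : ℕ} {u : Perm (Fin m)} {a b : Fin m}
    (h : ∀ c, a < c → c < b → u a < u c → ¬ u c < u b) : betweenCount u a b = 0 :=
  Finset.sum_eq_zero fun c _ => if_neg fun hc => h c hc.1 hc.2.1 hc.2.2.1 hc.2.2.2

theorem doubleLength_lt_mul_swap {n : ℕ} (u : Perm (Fin (2 * n))) {a b : Fin (2 * n)}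
    (hab : a < b) (hu : u a < u b) : doubleLength u < doubleLength (u * swap a b) := by
  rw [doubleLength_mul_swap u hab hu]
  have := betweenCount_nonneg u a b
  split_ifs <;> omega

theorem doubleLength_one (n : ℕ) : doubleLength (1 : Perm (Fin (2 * n))) = 0 := by
  rw [doubleLength, invCount, crossCount, Finset.sum_eq_zero, Finset.sum_eq_zero, add_zero]
  · intro c _
    exact if_neg fun h => absurd h.2 (not_le.2 h.1)
  · intro p _
    exact Finset.sum_eq_zero fun q _ => if_neg fun h => lt_asymm h.1 h.2

/-! ### Reflections of type C and their effect on length -/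

/-- The permutation underlying the reflection of type C which exchanges `a` and `b`. -/
def cswap {n : ℕ} (a b : Fin (2 * n)) : Perm (Fin (2 * n)) :=
  if b = a.rev then swap a b else swap a b * swap a.rev b.rev

theorem cswap_rev {n : ℕ} (a : Fin (2 * n)) : cswap a a.rev = swap a a.rev := if_pos rfl

theorem cswap_of_ne {n : ℕ} {a b : Fin (2 * n)} (h : b ≠ a.rev) :
    cswap a b = swap a b * swap a.rev b.rev := if_neg h

theorem ne_rev_self {n : ℕ} (a : Fin (2 * n)) : a ≠ a.rev := by
  intro h
  have := congrArg Fin.val h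
  rw [Fin.val_rev] at this
  omega

theorem cswap_apply {n : ℕ} (a b c : Fin (2 * n)) :
    cswap a b c = if c = a then b else if c = b then a else if c = a.rev then b.rev else
      if c = b.rev then a.rev else c := by
  have ha := ne_rev_self a
  have hb := ne_rev_self b
  by_cases h : b = a.rev
  · subst h
    rw [cswap_rev, swap_apply_def]
    simp only [Fin.rev_rev]
    split_ifs <;> simp_all
  · rw [cswap_of_ne h, Perm.mul_apply]
    have h' : a ≠ b.rev := fun e => h (by rw [e, Fin.rev_rev])
    simp only [swap_apply_def]
    split_ifs <;> simp_all

theorem cswap_comm {n : ℕ} (a b : Fin (2 * n)) : cswap a b = cswap b a := by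
  ext c
  rw [cswap_apply, cswap_apply]
  split_ifs <;> simp_all

theorem cswap_mem {n : ℕ} (a b : Fin (2 * n)) : cswap a b ∈ weylC n := by
  intro c
  have ha := ne_rev_self a
  have hb := ne_rev_self b
  by_cases h : b = a.rev
  · subst h
    simp only [cswap_rev, swap_apply_def, Fin.rev_eq_iff, Fin.rev_rev]
    split_ifs <;> simp_all
  have h' : a ≠ b.rev := fun e => h (by rw [e, Fin.rev_rev])
  simp only [cswap_apply, Fin.rev_eq_iff, Fin.rev_rev]
  by_cases h1 : c = a
  · subst h1; simp_all
  by_cases h2 : c = b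
  · subst h2; simp_all
  by_cases h3 : c = a.rev
  · subst h3; simp_all
  by_cases h4 : c = b.rev
  · subst h4; simp_all
  simp [h1, h2, h3, h4]

theorem conj_cswap {n : ℕ} {x : Perm (Fin (2 * n))} (hx : x ∈ weylC n) (a b : Fin (2 * n)) :
    x * cswap a b * x⁻¹ = cswap (x a) (x b) := by
  have hx' : ∀ a, x a.rev = (x a).rev := hx
  by_cases h : b = a.rev
  · subst h
    rw [cswap_rev, hx', cswap_rev, ← hx', swap_apply_apply]
  · have h' : x b ≠ (x a).rev := by rw [← hx']; exact x.injective.ne h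
    rw [cswap_of_ne h, cswap_of_ne h', ← hx', ← hx', swap_apply_apply, swap_apply_apply]
    group

/-- The reflection is one transposition or two mirror ones. In the latter case the mirror pair is
untouched by the first exchange, hence still in increasing order, so both exchanges raise the
statistic. -/
theorem doubleLength_lt_mul_cswap {n : ℕ} {u : Perm (Fin (2 * n))} (hu : u ∈ weylC n)
    {a b : Fin (2 * n)} (hab : a < b) (h : u a < u b) :
    doubleLength u < doubleLength (u * cswap a b) := by
  have hu' : ∀ a, u a.rev = (u a).rev := hu
  by_cases hb : b = a.rev
  · subst hb
    rw [cswap_rev]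
    exact doubleLength_lt_mul_swap u hab h
  · rw [cswap_of_ne hb, ← mul_assoc]
    refine (doubleLength_lt_mul_swap u hab h).trans ?_
    have hb' : a ≠ b.rev := fun e => hb (by rw [e, Fin.rev_rev])
    rw [swap_comm a.rev]
    refine doubleLength_lt_mul_swap _ (Fin.rev_lt_rev.2 hab) ?_
    rw [Perm.mul_apply, Perm.mul_apply, swap_apply_of_ne_of_ne hb'.symm (ne_rev_self b).symm,
      swap_apply_of_ne_of_ne (ne_rev_self a).symm (Ne.symm hb), hu', hu']
    exact Fin.rev_lt_rev.2 h

/-- One unit comes from the new inversion and one from the crossing term: `a` and `u a` both precede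
their mirror images, so both lie in the lower half. -/
theorem doubleLength_mul_cswap_rev {n : ℕ} {u : Perm (Fin (2 * n))} (hu : u ∈ weylC n)
    {a : Fin (2 * n)} (ha : a < a.rev) (h : u a < u a.rev)
    (hc : ∀ c, a < c → c < a.rev → u a < u c → ¬ u c < u a.rev) :
    doubleLength (u * cswap a a.rev) = doubleLength u + 2 := by
  have hu' : u a.rev = (u a).rev := hu a
  rw [cswap_rev, doubleLength_mul_swap u ha h, betweenCount_eq_zero hc, if_pos]
  · ring
  · rw [hu'] at h ⊢
    rw [Fin.lt_def, Fin.val_rev] at ha h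
    simp only [Fin.val_rev]
    omega

/-- Each of the two mirror transpositions adds one inversion. The hypothesis `hn` keeps the pair
from straddling the middle in position and in value at once, so no crossing term appears. -/
theorem doubleLength_mul_cswap_of_ne {n : ℕ} {u : Perm (Fin (2 * n))} (hu : u ∈ weylC n)
    {a b : Fin (2 * n)} (hab : a < b) (hb : b ≠ a.rev) (h : u a < u b)
    (hn : b.val < n ∨ n ≤ (u a).val)
    (hc : ∀ c, a < c → c < b → u a < u c → ¬ u c < u b) :
    doubleLength (u * cswap a b) = doubleLength u + 2 := by
  have hu' : ∀ a, u a.rev = (u a).rev := hu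
  have hb' : a ≠ b.rev := fun e => hb (by rw [e, Fin.rev_rev])
  have ea : (u * swap a b) a.rev = (u a).rev := by
    rw [Perm.mul_apply, swap_apply_of_ne_of_ne (ne_rev_self a).symm (Ne.symm hb), hu']
  have eb : (u * swap a b) b.rev = (u b).rev := by
    rw [Perm.mul_apply, swap_apply_of_ne_of_ne hb'.symm (ne_rev_self b).symm, hu']
  have h1 : a.val < b.val := hab
  have h2 : (u a).val < (u b).val := h
  rw [cswap_of_ne hb, ← mul_assoc, swap_comm a.rev, doubleLength_mul_swap _ (Fin.rev_lt_rev.2 hab)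
    (by rw [ea, eb]; exact Fin.rev_lt_rev.2 h), doubleLength_mul_swap u hab h,
    betweenCount_eq_zero hc, betweenCount_eq_zero, if_neg, if_neg]
  · ring
  · rw [ea, eb]
    simp only [Fin.val_rev]
    omega
  · omega
  · intro c h3 h4 h5 h6
    rw [eb] at h5
    rw [ea] at h6
    -- Only `a` and `b` have values altered by the first exchange. If one of them lay between in the
    -- mirror pair, both the positions and the values would straddle the middle, against `hn`.
    by_cases hca : c = a
    · subst hca
      rw [Perm.mul_apply, swap_apply_left] at h5 h6
      rw [Fin.lt_def, Fin.val_rev] at h3 h4 h5 h6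
      omega
    by_cases hcb : c = b
    · subst hcb
      rw [Perm.mul_apply, swap_apply_right] at h5 h6
      rw [Fin.lt_def, Fin.val_rev] at h3 h4 h5 h6
      omega
    rw [Perm.mul_apply, swap_apply_of_ne_of_ne hca hcb] at h5 h6
    refine hc c.rev (Fin.lt_rev_iff.2 h4) (Fin.rev_lt_iff.2 h3) ?_ ?_
    · rw [hu']; exact Fin.lt_rev_iff.2 h6
    · rw [hu']; exact Fin.rev_lt_iff.2 h5

/-! ### Bruhat covers and length -/

section Weyl

variable {W : Type*} [Group W] {S : Set W}

theorem BruhatLE.eq_or_length_lt {u w : W} (h : BruhatLE S u w) :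
    u = w ∨ length S u < length S w := by
  induction h with
  | refl => exact Or.inl rfl
  | tail _ h ih =>
    obtain ⟨t, -, -, hlt⟩ := h
    rcases ih with rfl | ih
    · exact Or.inr hlt
    · exact Or.inr (ih.trans hlt)

theorem bruhatCovBy_mul {u t : W} (ht : IsReflection S t)
    (hl : length S (u * t) = length S u + 1) : BruhatCovBy S u (u * t) := by
  refine ⟨.single ⟨t, ht, rfl, by omega⟩, fun e => ?_, fun v h1 h2 => ?_⟩
  · rw [← e] at hl
    omega
  · rcases h1.eq_or_length_lt with h1 | h1
    · exact Or.inl h1.symm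
    rcases h2.eq_or_length_lt with h2 | h2
    · exact Or.inr h2
    omega

/-- The first step of a chain from `u` to `w` ends at an element of the interval; it cannot be `u`,
since lengths increase strictly, so it is `w`. -/
theorem BruhatCovBy.exists_reflection {u w : W} (h : BruhatCovBy S u w) :
    ∃ t, IsReflection S t ∧ w = u * t ∧ length S u < length S w := by
  obtain ⟨h1, hne, h2⟩ := h
  rcases Relation.ReflTransGen.cases_head h1 with h1 | ⟨v, huv, hvw⟩
  · exact absurd h1 hne
  rcases h2 v (.single huv) hvw with rfl | rfl
  · obtain ⟨t, -, -, h⟩ := huv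
    exact absurd h (lt_irrefl _)
  · exact huv

end Weyl

/-! ### The length function and the reflections of the type C Weyl group -/

section WeylC

variable {n : ℕ}

/-- The reflection of type C which exchanges `a` and `b`. -/
def reflC (a b : Fin (2 * n)) : weylC n := ⟨cswap a b, cswap_mem a b⟩

theorem cswap_mul_self (a b : Fin (2 * n)) : cswap a b * cswap a b = 1 := by
  by_cases h : b = a.rev
  · subst h
    rw [cswap_rev, swap_mul_self]
  · ext c
    have ha := ne_rev_self a
    have hb := ne_rev_self b
    have h' : a ≠ b.rev := fun e => h (by rw [e, Fin.rev_rev])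
    rw [Perm.mul_apply, cswap_apply a b c, cswap_apply]
    split_ifs <;> simp_all

theorem reflC_val (a b : Fin (2 * n)) : (reflC a b).1 = cswap a b := rfl

theorem reflC_mul_self (a b : Fin (2 * n)) : reflC a b * reflC a b = 1 :=
  Subtype.ext (cswap_mul_self a b)

theorem mem_simpleC_iff {s : weylC n} :
    s ∈ simpleC n ↔ ∃ i j : Fin (2 * n), i.val + 1 = j.val ∧ j.val ≤ n ∧ s = reflC i j := by
  constructor
  · rintro ⟨i, j, hij, h | h⟩
    · refine ⟨i, j, hij, h.1.le, Subtype.ext ?_⟩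
      rw [h.2, reflC_val, cswap_of_ne, swap_comm i.rev]
      rw [Ne, Fin.ext_iff, Fin.val_rev]
      omega
    · refine ⟨i, j, hij, h.1.le, Subtype.ext ?_⟩
      have : j = i.rev := by rw [Fin.ext_iff, Fin.val_rev]; omega
      rw [h.2, reflC_val, this, cswap_rev]
  · rintro ⟨i, j, hij, hj, rfl⟩
    refine ⟨i, j, hij, ?_⟩
    rcases hj.lt_or_eq with hj | hj
    · refine Or.inl ⟨hj, ?_⟩
      rw [reflC_val, cswap_of_ne, swap_comm i.rev]
      rw [Ne, Fin.ext_iff, Fin.val_rev]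
      omega
    · refine Or.inr ⟨hj, ?_⟩
      have : j = i.rev := by rw [Fin.ext_iff, Fin.val_rev]; omega
      rw [reflC_val, this, cswap_rev]

theorem doubleLength_mul_simple {u : Perm (Fin (2 * n))} (hu : u ∈ weylC n) {i j : Fin (2 * n)}
    (hij : i.val + 1 = j.val) (hj : j.val ≤ n) (h : u i < u j) :
    doubleLength (u * cswap i j) = doubleLength u + 2 := by
  have hlt : i < j := by rw [Fin.lt_def]; omega
  have hc : ∀ c, i < c → c < j → u i < u c → ¬ u c < u j := by
    intro c h1 h2
    rw [Fin.lt_def] at h1 h2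
    omega
  rcases hj.lt_or_eq with hj | hj
  · refine doubleLength_mul_cswap_of_ne hu hlt ?_ h (Or.inl hj) hc
    rw [Ne, Fin.ext_iff, Fin.val_rev]
    omega
  · obtain rfl : j = i.rev := by rw [Fin.ext_iff, Fin.val_rev]; omega
    exact doubleLength_mul_cswap_rev hu hlt h hc

theorem mul_cswap_apply_left (u : Perm (Fin (2 * n))) (a b : Fin (2 * n)) :
    (u * cswap a b) a = u b := by
  rw [Perm.mul_apply, cswap_apply, if_pos rfl]

theorem mul_cswap_apply_right (u : Perm (Fin (2 * n))) (a b : Fin (2 * n)) :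
    (u * cswap a b) b = u a := by
  rw [cswap_comm, mul_cswap_apply_left]

theorem doubleLength_mul_simple_of_gt {u : Perm (Fin (2 * n))} (hu : u ∈ weylC n)
    {i j : Fin (2 * n)} (hij : i.val + 1 = j.val) (hj : j.val ≤ n) (h : u j < u i) :
    doubleLength (u * cswap i j) + 2 = doubleLength u := by
  rw [← doubleLength_mul_simple (mul_mem hu (cswap_mem i j)) hij hj, mul_assoc, cswap_mul_self,
    mul_one]
  rwa [mul_cswap_apply_left, mul_cswap_apply_right]

/-- Without descents up to the middle there are none beyond it, by mirror symmetry, and an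
increasing permutation is the identity. -/
theorem exists_simple_descent {u : Perm (Fin (2 * n))} (hu : u ∈ weylC n) (h1 : u ≠ 1) :
    ∃ i j : Fin (2 * n), i.val + 1 = j.val ∧ j.val ≤ n ∧ u j < u i := by
  by_contra! h
  have hu' : ∀ a, u a.rev = (u a).rev := hu
  have hadj : ∀ i j : Fin (2 * n), i.val + 1 = j.val → u i < u j := by
    intro i j hij
    refine lt_of_le_of_ne ?_ (u.injective.ne (by rw [Ne, Fin.ext_iff]; omega))
    by_cases hj : j.val ≤ n
    · exact h i j hij hj
    · rw [← Fin.rev_le_rev, ← hu', ← hu']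
      exact h j.rev i.rev (by simp only [Fin.val_rev]; omega) (by rw [Fin.val_rev]; omega)
  have hmono : ∀ k : ℕ, ∀ i j : Fin (2 * n), i.val + k + 1 = j.val → u i < u j := by
    intro k
    induction k with
    | zero => exact fun i j hij => hadj i j (by omega)
    | succ k ih =>
      intro i j hij
      exact (ih i ⟨j.val - 1, by omega⟩ (by simp only; omega)).trans
        (hadj _ _ (by simp only; omega))
  have hs : StrictMono u := fun i j hij =>
    hmono (j.val - i.val - 1) i j (by rw [Fin.lt_def] at hij; omega)
  exact h1 (Equiv.ext fun x => congrFun ((hs.range_inj strictMono_id).1 (by simp)) x)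

theorem doubleLength_nonneg (u : Perm (Fin (2 * n))) : 0 ≤ doubleLength u :=
  add_nonneg
    (Finset.sum_nonneg fun _ _ => Finset.sum_nonneg fun _ _ => by split_ifs <;> simp)
    (Finset.sum_nonneg fun _ _ => by split_ifs <;> simp)

theorem exists_word (k : ℕ) : ∀ w : weylC n, doubleLength w.1 ≤ k →
    ∃ l : List (weylC n), (∀ s ∈ l, s ∈ simpleC n) ∧ l.prod = w ∧
      2 * (l.length : ℤ) = doubleLength w.1 := by
  induction k with
  | zero =>
    intro w hw
    by_cases h1 : w.1 = 1
    · exact ⟨[], by simp, by simpa using (Subtype.ext h1).symm, by simp [h1, doubleLength_one]⟩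
    · obtain ⟨i, j, hij, hj, h⟩ := exists_simple_descent w.2 h1
      have := doubleLength_mul_simple_of_gt w.2 hij hj h
      have := doubleLength_nonneg (w.1 * cswap i j)
      push_cast at hw
      omega
  | succ k ih =>
    intro w hw
    by_cases h1 : w.1 = 1
    · exact ⟨[], by simp, by simpa using (Subtype.ext h1).symm, by simp [h1, doubleLength_one]⟩
    · obtain ⟨i, j, hij, hj, h⟩ := exists_simple_descent w.2 h1
      have hd := doubleLength_mul_simple_of_gt w.2 hij hj h
      obtain ⟨l, hl, hp, hlen⟩ := ih (w * reflC i j) (by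
        change doubleLength (w.1 * cswap i j) ≤ _
        push_cast at hw
        omega)
      refine ⟨l ++ [reflC i j], ?_, ?_, ?_⟩
      · intro s hs
        rcases List.mem_append.1 hs with hs | hs
        · exact hl s hs
        · rw [List.mem_singleton.1 hs]
          exact mem_simpleC_iff.2 ⟨i, j, hij, hj, rfl⟩
      · rw [List.prod_append, hp, List.prod_singleton, mul_assoc, reflC_mul_self, mul_one]
      · change _ = doubleLength (w.1 * cswap i j) at hlen
        rw [List.length_append, List.length_singleton]
        push_cast
        omega

theorem doubleLength_prod_le (l : List (weylC n)) (hl : ∀ s ∈ l, s ∈ simpleC n) :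
    doubleLength l.prod.1 ≤ 2 * (l.length : ℤ) := by
  induction l using List.reverseRecOn with
  | nil => simp [doubleLength_one]
  | append_singleton l s ih =>
    have h1 := ih fun s hs => hl s (List.mem_append_left _ hs)
    obtain ⟨i, j, hij, hj, rfl⟩ := mem_simpleC_iff.1 (hl s (by simp))
    rw [List.prod_append, List.prod_singleton, List.length_append, List.length_singleton]
    change doubleLength (l.prod.1 * cswap i j) ≤ _
    rw [Nat.cast_add, Nat.cast_one]
    rcases lt_or_gt_of_ne (l.prod.1.injective.ne (show i ≠ j by rw [Ne, Fin.ext_iff]; omega))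
      with h | h
    · have := doubleLength_mul_simple l.prod.2 hij hj h
      omega
    · have := doubleLength_mul_simple_of_gt l.prod.2 hij hj h
      omega

/-- Right multiplication by a generator changes `doubleLength` by exactly two in either direction,
which bounds the length from below; removing descents one at a time gives a word attaining the
bound. -/
theorem two_mul_length (w : weylC n) :
    2 * (length (simpleC n) w : ℤ) = doubleLength w.1 := by
  obtain ⟨l, hl, hp, hlen⟩ := exists_word (doubleLength w.1).toNat w (by omega)
  apply le_antisymm
  · rw [← hlen]
    have : length (simpleC n) w ≤ l.length := Nat.sInf_le ⟨l, rfl, hl, hp⟩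
    omega
  · obtain ⟨l', hl', hs, hp'⟩ := Nat.sInf_mem
      (⟨l.length, l, rfl, hl, hp⟩ : {m | ∃ l : List (weylC n), l.length = m ∧
        (∀ s ∈ l, s ∈ simpleC n) ∧ l.prod = w}.Nonempty)
    have := doubleLength_prod_le l' hs
    rw [hp', hl'] at this
    exact this

theorem IsReflection.exists_eq_reflC {t : weylC n} (ht : IsReflection (simpleC n) t) :
    ∃ a b : Fin (2 * n), a < b ∧ t = reflC a b := by
  obtain ⟨x, s, hs, rfl⟩ := ht
  obtain ⟨i, j, hij, -, rfl⟩ := mem_simpleC_iff.1 hs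
  have e : x * reflC i j * x⁻¹ = reflC (x.1 i) (x.1 j) := Subtype.ext (conj_cswap x.2 i j)
  rw [e]
  rcases lt_or_gt_of_ne (x.1.injective.ne (show i ≠ j by rw [Ne, Fin.ext_iff]; omega)) with h | h
  · exact ⟨_, _, h, rfl⟩
  · exact ⟨_, _, h, Subtype.ext (cswap_comm _ _)⟩

/-- By `conj_cswap` it suffices to carry a simple pair to `(a, b)` inside the group: the middle pair
when `b` mirrors `a`, and the first two letters otherwise. -/
theorem isReflection_reflC {a b : Fin (2 * n)} (hab : a ≠ b) :
    IsReflection (simpleC n) (reflC a b) := by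
  have ha := a.isLt
  suffices ∃ x : weylC n, ∃ i j : Fin (2 * n), i.val + 1 = j.val ∧ j.val ≤ n ∧
      x.1 i = a ∧ x.1 j = b by
    obtain ⟨x, i, j, hij, hj, rfl, rfl⟩ := this
    exact ⟨x, reflC i j, mem_simpleC_iff.2 ⟨i, j, hij, hj, rfl⟩,
      Subtype.ext (conj_cswap x.2 i j).symm⟩
  by_cases hb : b = a.rev
  · let i : Fin (2 * n) := ⟨n - 1, by omega⟩
    have hi : (reflC i a).1 i = a := by
      change cswap i a i = a
      rw [cswap_apply, if_pos rfl]
    have hrev : i.rev.val = n := by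
      simp only [Fin.val_rev, i]
      omega
    refine ⟨reflC i a, i, i.rev, ?_, hrev.le, hi, ?_⟩
    · rw [hrev]
      simp only [i]
      omega
    · rw [(reflC i a).2 i, hi, hb]
  · have hn : 2 ≤ n := by
      have h1 := b.isLt
      rw [Ne, Fin.ext_iff] at hab
      rw [Fin.ext_iff, Fin.val_rev] at hb
      omega
    let i : Fin (2 * n) := ⟨0, by omega⟩
    let j : Fin (2 * n) := ⟨1, by omega⟩
    let x : weylC n := reflC i a
    have hx : ∀ c, x.1 (x.1 c) = c := fun c => by
      rw [← Perm.mul_apply]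
      exact congrArg (fun f : weylC n => f.1 c) (reflC_mul_self i a)
    have hxi : x.1 i = a := by
      change cswap i a i = a
      rw [cswap_apply, if_pos rfl]
    have hxa : x.1 a = i := by rw [← hxi, hx]
    have h1 : x.1 b ≠ i := by
      rw [← hxa]
      exact x.1.injective.ne hab.symm
    have h2 : x.1 b ≠ i.rev := by
      rw [← hxa, ← x.2 a]
      exact x.1.injective.ne hb
    have h3 : i ≠ j := by simp [i, j]
    have h4 : i ≠ j.rev := by
      rw [Ne, Fin.ext_iff, Fin.val_rev]
      simp only [i, j]
      omega
    have h5 : i ≠ (x.1 b).rev := fun e => h2 (by rw [e, Fin.rev_rev])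
    have e1 : cswap j (x.1 b) i = i := by
      rw [cswap_apply, if_neg h3, if_neg h1.symm, if_neg h4, if_neg h5]
    have e2 : cswap j (x.1 b) j = x.1 b := by rw [cswap_apply, if_pos rfl]
    refine ⟨x * reflC j (x.1 b), i, j, by simp [i, j], by simp only [j]; omega, ?_, ?_⟩
    · change x.1 (cswap j (x.1 b) i) = a
      rw [e1, hxi]
    · change x.1 (cswap j (x.1 b) j) = b
      rw [e2, hx]

/-! ### The parabolic Bruhat order and pointwise comparison on the first half -/

theorem length_lt_length_iff {u w : weylC n} :
    length (simpleC n) u < length (simpleC n) w ↔ doubleLength u.1 < doubleLength w.1 := by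
  rw [← two_mul_length, ← two_mul_length]
  omega

theorem apply_lt_apply_of_length_lt {u : weylC n} {a b : Fin (2 * n)} (hab : a < b)
    (h : length (simpleC n) u < length (simpleC n) (u * reflC a b)) : u.1 a < u.1 b := by
  by_contra hlt
  have hlt : u.1 b < u.1 a := lt_of_le_of_ne (not_lt.1 hlt) (u.1.injective.ne hab.ne')
  rw [length_lt_length_iff] at h
  have := doubleLength_lt_mul_cswap (mul_mem u.2 (cswap_mem a b)) hab
    (by rwa [mul_cswap_apply_left, mul_cswap_apply_right])
  rw [mul_assoc, cswap_mul_self, mul_one] at this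
  exact lt_asymm h this

theorem reflC_mem_parabolicC {a b : Fin (2 * n)} (h : a.val < n ↔ b.val < n) :
    reflC a b ∈ parabolicC n := by
  rw [parabolicC, Subgroup.mem_subgroupOf]
  intro c
  change (cswap a b c).val < n ↔ _
  rw [cswap_apply]
  split_ifs with h1 h2 h3 h4
  · rw [h1, h]
  · rw [h2, h]
  · rw [h3, Fin.val_rev, Fin.val_rev]
    omega
  · rw [h4, Fin.val_rev, Fin.val_rev]
    omega
  · rfl

theorem mul_cswap_apply_ge {u : Perm (Fin (2 * n))} (hu : u ∈ weylC n) {a b : Fin (2 * n)}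
    (ha : a.val < n) (hb : n ≤ b.val) (h : u a < u b) {c : Fin (2 * n)} (hc : c.val < n) :
    u c ≤ (u * cswap a b) c := by
  have hu' : ∀ a, u a.rev = (u a).rev := hu
  rw [Perm.mul_apply, cswap_apply]
  split_ifs with h1 h2 h3 h4
  · rw [h1]
    exact h.le
  · rw [h2] at hc
    omega
  · rw [h3, Fin.val_rev] at hc
    omega
  · rw [h4, hu', hu', Fin.rev_le_rev]
    exact h.le
  · exact le_rfl

theorem PBruhatLE.apply_le {u w : weylC n} (h : PBruhatLE (simpleC n) (parabolicC n) u w) :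
    ∀ c : Fin (2 * n), c.val < n → u.1 c ≤ w.1 c := by
  induction h with
  | refl => exact fun c _ => le_rfl
  | @tail v w _ h ih =>
    intro c hc
    refine (ih c hc).trans ?_
    obtain ⟨hcov, hne⟩ := h
    obtain ⟨t, ht, rfl, hlt⟩ := hcov.exists_reflection
    obtain ⟨a, b, hab, rfl⟩ := ht.exists_eq_reflC
    have hp : ¬ (a.val < n ↔ b.val < n) := fun h => hne (QuotientGroup.eq.2 (by
      rw [inv_mul_cancel_left]
      exact reflC_mem_parabolicC h))
    rw [Fin.lt_def] at hab
    exact mul_cswap_apply_ge v.2 (by omega) (by omega) (apply_lt_apply_of_length_lt hab hlt) hc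

theorem pBruhatLE_single {u : weylC n} {a b : Fin (2 * n)} (ha : a.val < n) (hb : n ≤ b.val)
    (h : doubleLength (u.1 * cswap a b) = doubleLength u.1 + 2) :
    PBruhatLE (simpleC n) (parabolicC n) u (u * reflC a b) := by
  have hab : a ≠ b := by rintro rfl; omega
  refine .single ⟨bruhatCovBy_mul (isReflection_reflC hab) ?_, fun e => ?_⟩
  · have h1 := two_mul_length u
    have h2 := two_mul_length (u * reflC a b)
    change _ = doubleLength (u.1 * cswap a b) at h2
    omega
  · have h1 := QuotientGroup.eq.1 e
    rw [inv_mul_cancel_left, parabolicC, Subgroup.mem_subgroupOf] at h1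
    have h2 : (cswap a b a).val < n ↔ a.val < n := h1 a
    rw [cswap_apply, if_pos rfl] at h2
    omega

/-- A greedy choice: among first-half positions where `u` falls short of `w`, take `a` with `u a`
largest; among second-half positions with `w b ≤ u a < u b ≤ w a`, take `b` with `u b` smallest.
These bounds keep the exchanged permutation below `w`, and the two extremal choices make the
exchange a cover. -/
theorem exists_pBruhat_step {u w : Perm (Fin (2 * n))} (hu : u ∈ weylC n) (hw : w ∈ weylC n)
    (hmono : ∀ a b : Fin (2 * n), a < b → b.val < n → w a < w b)
    (hle : ∀ c : Fin (2 * n), c.val < n → u c ≤ w c) (hne : u ≠ w) :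
    ∃ a b : Fin (2 * n), a.val < n ∧ n ≤ b.val ∧
      doubleLength (u * cswap a b) = doubleLength u + 2 ∧
      ∀ c : Fin (2 * n), c.val < n → (u * cswap a b) c ≤ w c := by
  have hu' : ∀ a, u a.rev = (u a).rev := hu
  have hw' : ∀ a, w a.rev = (w a).rev := hw
  have hrev : ∀ c : Fin (2 * n), n ≤ c.val → c.rev.val < n := fun c hc => by
    rw [Fin.val_rev]; omega
  have hge : ∀ c : Fin (2 * n), n ≤ c.val → w c ≤ u c := fun c hc => by
    have := hle c.rev (hrev c hc)
    rwa [hu', hw', Fin.rev_le_rev] at this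
  have hmono' : ∀ a b : Fin (2 * n), a < b → n ≤ a.val → w a < w b := fun a b hab ha => by
    have := hmono b.rev a.rev (Fin.rev_lt_rev.2 hab) (hrev a ha)
    rwa [hw', hw', Fin.rev_lt_rev] at this
  -- a position of largest value among those below `n` where `u` and `w` differ
  have hA : (Finset.univ.filter fun a : Fin (2 * n) => a.val < n ∧ u a < w a).Nonempty := by
    by_contra hA
    have hA : ∀ a : Fin (2 * n), a.val < n → ¬ u a < w a := by
      simpa [Finset.filter_eq_empty_iff] using hA
    have heq : ∀ c : Fin (2 * n), c.val < n → u c = w c := fun c hc =>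
      (hle c hc).eq_of_not_lt (hA c hc)
    refine hne (Equiv.ext fun c => ?_)
    rcases lt_or_ge c.val n with hc | hc
    · exact heq c hc
    · have := heq c.rev (hrev c hc)
      rwa [hu', hw', Fin.rev_inj] at this
  obtain ⟨a, ha, hamax⟩ := Finset.exists_max_image _ u hA
  simp only [Finset.mem_filter, Finset.mem_univ, true_and] at ha hamax
  obtain ⟨han, hlt⟩ := ha
  have hfix : ∀ c : Fin (2 * n), c.val < n → u a < u c → w c = u c := fun c hc h =>
    ((hle c hc).eq_of_not_lt fun h' => not_le.2 h (hamax c ⟨hc, h'⟩)).symm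
  -- a position of smallest value which can be exchanged with it
  have hB : (Finset.univ.filter fun b : Fin (2 * n) =>
      n ≤ b.val ∧ w b ≤ u a ∧ u a < u b ∧ u b ≤ w a).Nonempty := by
    by_contra hB
    have hB : ∀ b : Fin (2 * n), n ≤ b.val → u a < u b → u b ≤ w a → u a < w b := by
      intro b hb h1 h2
      by_contra h3
      exact hB ⟨b, by simpa using ⟨hb, not_lt.1 h3, h1, h2⟩⟩
    -- Both sets are preimages of the interval `Ioc (u a) (w a)`, under `u` and under `w`, so they
    -- have equal size. Without a suitable `b` the first is contained in the second, so they
    -- coincide; but `a` lies only in the second.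
    let T := Finset.univ.filter fun c : Fin (2 * n) => u a < u c ∧ u c ≤ w a
    let T' := Finset.univ.filter fun c : Fin (2 * n) => u a < w c ∧ w c ≤ w a
    have hsub : T ⊆ T' := by
      intro c hc
      simp only [T, T', Finset.mem_filter, Finset.mem_univ, true_and] at hc ⊢
      rcases lt_or_ge c.val n with hcn | hcn
      · rwa [hfix c hcn hc.1]
      · exact ⟨hB c hcn hc.1 hc.2, (hge c hcn).trans hc.2⟩
    have hcard : T.card = T'.card := by
      have h1 : T.card = (Finset.Ioc (u a) (w a)).card := by
        rw [← Finset.card_map u.toEmbedding]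
        congr 1
        ext x
        simp only [T, Finset.mem_map_equiv, Finset.mem_filter, Finset.mem_univ, true_and,
          apply_symm_apply, Finset.mem_Ioc]
      have h2 : T'.card = (Finset.Ioc (u a) (w a)).card := by
        rw [← Finset.card_map w.toEmbedding]
        congr 1
        ext x
        simp only [T', Finset.mem_map_equiv, Finset.mem_filter, Finset.mem_univ, true_and,
          apply_symm_apply, Finset.mem_Ioc]
      rw [h1, h2]
    have haT : a ∈ T := by
      rw [Finset.eq_of_subset_of_card_le hsub hcard.ge]
      simp [T', hlt]
    simp [T] at haT
  obtain ⟨b, hb, hbmin⟩ := Finset.exists_min_image _ u hB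
  simp only [Finset.mem_filter, Finset.mem_univ, true_and] at hb hbmin
  obtain ⟨hbn, hwb, hab, hbw⟩ := hb
  have hpos : a < b := by rw [Fin.lt_def]; omega
  -- A first-half `c` would be fixed by the choice of `a`, contradicting that `w` increases there; a
  -- second-half `c` would satisfy `w c < w b ≤ u a` and beat `b`.
  have hbetween : ∀ c, a < c → c < b → u a < u c → ¬ u c < u b := by
    intro c h1 h2 h3 h4
    rcases lt_or_ge c.val n with hcn | hcn
    · have h5 := hmono a c h1 hcn
      rw [hfix c hcn h3] at h5
      exact absurd (h4.trans_le hbw) (lt_asymm h5)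
    · exact not_le.2 h4 (hbmin c ⟨hcn, (hmono' c b h2 hcn).le.trans hwb, h3, h4.le.trans hbw⟩)
  refine ⟨a, b, han, hbn, ?_, ?_⟩
  · by_cases hba : b = a.rev
    · subst hba
      exact doubleLength_mul_cswap_rev hu hpos hab hbetween
    · refine doubleLength_mul_cswap_of_ne hu hpos hba hab (Or.inr ?_) hbetween
      -- If `u a` were in the lower half, `a.rev` would itself be a candidate with value at most `u
      -- b`, so minimality would force `b = a.rev`.
      by_contra hua
      have harev : n ≤ a.rev.val := by rw [Fin.val_rev]; omega
      have hlt1 : u a < u a.rev := by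
        rw [hu', Fin.lt_def, Fin.val_rev]
        omega
      have hle1 : u a.rev ≤ u b := by
        by_contra hcon
        have h1 : u a < u b.rev := by
          rw [hu'] at hcon ⊢
          exact Fin.lt_rev_iff.2 (not_le.1 hcon)
        have h2 := hfix b.rev (hrev b hbn) h1
        rw [hu', hw', Fin.rev_inj] at h2
        exact absurd hab (not_lt.2 (h2 ▸ hwb))
      have h3 := hbmin a.rev ⟨harev, by
        rw [hw']
        exact Fin.rev_le_iff.2 (by rw [← hu']; exact hle1.trans hbw), hlt1, hle1.trans hbw⟩
      exact hba (u.injective (le_antisymm h3 hle1))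
  · intro c hc
    rw [Perm.mul_apply, cswap_apply]
    split_ifs with h1 h2 h3 h4
    · rwa [h1]
    · rw [h2] at hc
      omega
    · rw [h3, Fin.val_rev] at hc
      omega
    · rw [h4, hu', hw', Fin.rev_le_rev]
      exact hwb
    · exact hle c hc

/-- Each step raises `doubleLength`, which is bounded on the finite group, so the chain of covers
must stop, and it can stop only at `w`. -/
theorem pBruhatLE_of_apply_le {w : weylC n}
    (hmono : ∀ a b : Fin (2 * n), a < b → b.val < n → w.1 a < w.1 b) (u : weylC n)
    (hle : ∀ c : Fin (2 * n), c.val < n → u.1 c ≤ w.1 c) :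
    PBruhatLE (simpleC n) (parabolicC n) u w := by
  obtain ⟨M, hM⟩ := (Set.finite_range fun u : weylC n => doubleLength u.1).bddAbove
  have hM : ∀ u : weylC n, doubleLength u.1 ≤ M := fun u => hM ⟨u, rfl⟩
  obtain ⟨k, hk⟩ : ∃ k : ℕ, M - doubleLength u.1 ≤ k := ⟨_, Int.self_le_toNat _⟩
  induction k using Nat.strong_induction_on generalizing u with
  | _ k ih =>
    by_cases hne : u = w
    · subst hne
      exact .refl
    obtain ⟨a, b, ha, hb, hl, hle'⟩ :=
      exists_pBruhat_step u.2 w.2 hmono hle fun e => hne (Subtype.ext e)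
    have hstep := pBruhatLE_single ha hb hl
    have h1 := hM (u * reflC a b)
    change doubleLength (u.1 * cswap a b) ≤ M at h1
    refine hstep.trans (ih (k - 1) (by omega) (u * reflC a b) hle' ?_)
    change M - doubleLength (u.1 * cswap a b) ≤ _
    omega

end WeylC

/-! ### Values, boundedness and symmetry of `fPerm` -/

theorem AffinePerm.apply_add_mul {m : ℕ} (f : AffinePerm m) (i q : ℤ) :
    f.1 (i + q * m) = f.1 i + q * m := by
  have hf : ∀ i : ℤ, f.1 (i + m) = f.1 i + m := f.2
  induction q using Int.induction_on with
  | zero => simp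
  | succ q ih => rw [add_mul, one_mul, ← add_assoc, hf, ih, add_assoc]
  | pred q ih =>
    have h := hf (i + (-q - 1) * m)
    rw [show i + (-(q : ℤ) - 1) * m + m = i + -q * m by ring, ih] at h
    linarith

theorem exists_eq_residue (m : ℕ) [NeZero m] (i : ℤ) :
    ∃ (q : ℤ) (r : Fin m), i = (r.val + 1 : ℤ) + q * m :=
  ⟨(residue m i).1, (residue m i).2, by
    rw [← residue_symm_apply, Prod.mk.eta, Equiv.symm_apply_apply]⟩

theorem AffinePerm.ext_of_residue {m : ℕ} [NeZero m] {f g : AffinePerm m}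
    (h : ∀ r : Fin m, f.1 (r.val + 1 : ℤ) = g.1 (r.val + 1 : ℤ)) : f = g := by
  refine Subtype.ext (Equiv.ext fun i => ?_)
  obtain ⟨q, r, rfl⟩ := exists_eq_residue m i
  rw [AffinePerm.apply_add_mul f, AffinePerm.apply_add_mul g, h]

theorem fPerm_eq_ofResidue (k m : ℕ) [NeZero m] (u w : Perm (Fin m)) :
    fPerm k m u w =
      ofResidue m (u * w⁻¹) fun r => if (w⁻¹ r).val < k then 1 else 0 := by
  have hinv : (extend m w)⁻¹ = extend m w⁻¹ := by
    rw [inv_eq_iff_mul_eq_one, extend, extend, ofResidue_mul, mul_inv_cancel]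
    refine AffinePerm.ext_of_residue fun r => ?_
    have := ofResidue_apply m 1 (fun _ => (0 : Fin m → ℤ) r + (0 : Fin m → ℤ) (w⁻¹ r)) 0 r
    simpa using this
  rw [fPerm, hinv, extend, extend, translation, ofResidue_mul, ofResidue_mul, mul_one]
  simp

theorem fPerm_apply (k m : ℕ) [NeZero m] (u w : Perm (Fin m)) (r : Fin m) :
    (fPerm k m u w).1 ((w r).val + 1 : ℤ) =
      ((u r).val + 1 : ℤ) + if r.val < k then (m : ℤ) else 0 := by
  have h := ofResidue_apply m (u * w⁻¹) (fun r => if (w⁻¹ r).val < k then 1 else 0) 0 (w r)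
  rw [← fPerm_eq_ofResidue] at h
  simpa using h

theorem sum_Icc_eq_sum_fin (m : ℕ) (g : ℤ → ℤ) :
    ∑ i ∈ Finset.Icc (1 : ℤ) m, g i = ∑ r : Fin m, g (r.val + 1 : ℤ) := by
  refine (Finset.sum_bij (fun (r : Fin m) _ => (r.val + 1 : ℤ)) ?_ ?_ ?_ fun _ _ => rfl).symm
  · intro r _
    rw [Finset.mem_Icc]
    omega
  · intro r _ s _ h
    rw [Fin.ext_iff]
    omega
  · intro i hi
    rw [Finset.mem_Icc] at hi
    exact ⟨⟨(i - 1).toNat, by omega⟩, Finset.mem_univ _, by simp only; omega⟩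

theorem sum_perm_val {m : ℕ} (u : Perm (Fin m)) :
    ∑ r, ((u r).val : ℤ) = ∑ r : Fin m, (r.val : ℤ) :=
  Equiv.sum_comp u fun r => (r.val : ℤ)

theorem fPerm_mem_Bd {n : ℕ} [NeZero n] {u w : Perm (Fin (2 * n))}
    (hle : ∀ c : Fin (2 * n), c.val < n → u c ≤ w c)
    (hge : ∀ c : Fin (2 * n), n ≤ c.val → w c ≤ u c) : fPerm n (2 * n) u w ∈ Bd n (2 * n) := by
  refine ⟨?_, fun i => ?_⟩
  · rw [sum_Icc_eq_sum_fin, ← Equiv.sum_comp w]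
    simp only [fPerm_apply]
    have hcard : (Finset.univ.filter fun r : Fin (2 * n) => r.val < n).card = n := by
      rw [Fin.card_filter_val_lt]
      omega
    have hsum : ∑ r : Fin (2 * n), (if r.val < n then ((2 * n : ℕ) : ℤ) else 0) =
        (2 * n : ℕ) * n := by
      rw [← Finset.sum_filter, Finset.sum_const, hcard, nsmul_eq_mul, mul_comm]
    rw [Finset.sum_sub_distrib, Finset.sum_add_distrib, Finset.sum_add_distrib,
      Finset.sum_add_distrib, sum_perm_val, sum_perm_val, hsum]
    ring
  · obtain ⟨q, r, rfl⟩ := exists_eq_residue (2 * n) i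
    obtain ⟨c, rfl⟩ := w.surjective r
    rw [AffinePerm.apply_add_mul, fPerm_apply]
    generalize q * ((2 * n : ℕ) : ℤ) = Q
    have h1 := (u c).isLt
    have h2 := (w c).isLt
    split_ifs with hc
    · have := hle c hc
      rw [Fin.le_def] at this
      omega
    · have := hge c (not_lt.1 hc)
      rw [Fin.le_def] at this
      omega

theorem fPerm_symmetric {n : ℕ} [NeZero n] {u w : Perm (Fin (2 * n))} (hu : u ∈ weylC n)
    (hw : w ∈ weylC n) (a : ℤ) (h1 : 1 ≤ a) (h2 : a ≤ 2 * (n : ℤ)) :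
    (fPerm n (2 * n) u w).1 (2 * (n : ℤ) + 1 - a) =
      4 * (n : ℤ) + 1 - (fPerm n (2 * n) u w).1 a := by
  obtain ⟨r, rfl⟩ : ∃ r : Fin (2 * n), (r.val + 1 : ℤ) = a :=
    ⟨⟨(a - 1).toNat, by omega⟩, by simp only; omega⟩
  obtain ⟨c, rfl⟩ := w.surjective r
  have hrev : 2 * (n : ℤ) + 1 - ((w c).val + 1) = (w c.rev).val + 1 := by
    have := (w c).isLt
    rw [hw c, Fin.val_rev]
    omega
  have := (u c).isLt
  have hc : c.rev.val < n ↔ ¬ c.val < n := by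
    rw [Fin.val_rev]
    omega
  rw [hrev, fPerm_apply, fPerm_apply, hu c, Fin.val_rev, if_congr hc rfl rfl]
  split_ifs <;> omega

/-! ### Recovering a pair `u`, `w` from a symmetric bounded affine permutation -/

/-- An element of the Weyl group of type C which maps the first `n` letters increasingly onto a
set that contains exactly one letter of each pair `a`, `a.rev`. -/
theorem exists_increasing_weylC {n : ℕ} (I : Finset (Fin (2 * n)))
    (hI : ∀ r, r.rev ∈ I ↔ r ∉ I) :
    ∃ w ∈ weylC n, (∀ a b : Fin (2 * n), a < b → b.val < n → w a < w b) ∧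
      ∀ c, w c ∈ I ↔ c.val < n := by
  have hcard : I.card = n := by
    have h : Iᶜ = I.map Fin.revPerm.toEmbedding := by
      ext r
      rw [Finset.mem_compl, Finset.mem_map_equiv, Fin.revPerm_symm, Fin.revPerm_apply, hI]
    have h1 := Finset.card_add_card_compl I
    rw [h, Finset.card_map, Fintype.card_fin] at h1
    omega
  let e := I.orderEmbOfFin hcard
  have he : ∀ i, e i ∈ I := Finset.orderEmbOfFin_mem I hcard
  have he' : ∀ i, (e i).rev ∉ I := fun i h => (hI _).1 h (he i)
  let g : Fin (2 * n) → Fin (2 * n) := fun c =>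
    if h : c.val < n then e ⟨c.val, h⟩ else (e ⟨c.rev.val, by rw [Fin.val_rev]; omega⟩).rev
  have hlt : ∀ (c : Fin (2 * n)) (h : c.val < n), g c = e ⟨c.val, h⟩ := fun c h => dif_pos h
  have hge : ∀ (c : Fin (2 * n)) (h : ¬ c.val < n),
      g c = (e ⟨c.rev.val, by rw [Fin.val_rev]; omega⟩).rev := fun c h => dif_neg h
  have hmem : ∀ c, g c ∈ I ↔ c.val < n := by
    intro c
    by_cases h : c.val < n
    · simp only [hlt c h, he, h]
    · simp only [hge c h, he', h]
  have hinj : Function.Injective g := by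
    intro a b hab
    have hiff : a.val < n ↔ b.val < n := by rw [← hmem, ← hmem, hab]
    by_cases ha : a.val < n
    · rw [hlt a ha, hlt b (hiff.1 ha), e.injective.eq_iff, Fin.mk.injEq] at hab
      exact Fin.ext hab
    · have hb : ¬ b.val < n := fun h => ha (hiff.2 h)
      rw [hge a ha, hge b hb, Fin.rev_inj, e.injective.eq_iff, Fin.mk.injEq] at hab
      exact Fin.rev_inj.1 (Fin.ext hab)
  refine ⟨Equiv.ofBijective g (Finite.injective_iff_bijective.1 hinj), ?_, ?_, hmem⟩
  · intro c
    change g c.rev = (g c).rev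
    by_cases h : c.val < n
    · have h' : ¬ c.rev.val < n := by rw [Fin.val_rev]; omega
      rw [hlt c h, hge c.rev h']
      simp only [Fin.rev_rev]
    · have h' : c.rev.val < n := by rw [Fin.val_rev]; omega
      rw [hge c h, hlt c.rev h', Fin.rev_rev]
  · intro a b hab hb
    change g a < g b
    rw [hlt a (lt_trans (Fin.lt_def.1 hab) hb), hlt b hb, e.lt_iff_lt]
    exact hab

/-- The values of a bounded affine permutation, written with a residue permutation. -/
theorem exists_perm_of_bounded {m : ℕ} [NeZero m] (f : AffinePerm m)
    (hf : ∀ i : ℤ, i ≤ f.1 i ∧ f.1 i ≤ i + m) :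
    ∃ s : Perm (Fin m), ∀ r : Fin m, f.1 (r.val + 1 : ℤ) =
      ((s r).val + 1 : ℤ) + if (m : ℤ) < f.1 (r.val + 1 : ℤ) then (m : ℤ) else 0 := by
  have hper : ∀ i : ℤ, f.1 (i + m) = f.1 i + m := f.2
  have hex : ∀ r : Fin m, ∃ s : Fin m, f.1 (r.val + 1 : ℤ) =
      (s.val + 1 : ℤ) + if (m : ℤ) < f.1 (r.val + 1 : ℤ) then (m : ℤ) else 0 := by
    intro r
    -- The value lies in `[1, 2m]`, so at most one period has to be removed; a value equal to `m`
    -- stays in the unshifted range.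
    have h1 := hf (r.val + 1)
    have h2 := r.isLt
    split_ifs with h
    · exact ⟨⟨(f.1 (r.val + 1) - 1 - m).toNat, by omega⟩, by simp only; omega⟩
    · exact ⟨⟨(f.1 (r.val + 1) - 1).toNat, by omega⟩, by simp only; omega⟩
  choose s hs using hex
  -- Equal residues make the values of `f` differ by `0` or `m`, hence the arguments too by
  -- periodicity; two letters of one period cannot differ by `m`.
  have hinj : Function.Injective s := by
    intro a b hab
    have ha := hs a
    have hb := hs b
    rw [hab] at ha
    rw [Fin.ext_iff]
    have h1 := a.isLt
    have h2 := b.isLt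
    split_ifs at ha hb
    · have := f.1.injective (ha.trans hb.symm)
      omega
    · have := f.1.injective ((ha.trans (by rw [hb, add_zero])).trans (hper (b.val + 1)).symm)
      omega
    · have := f.1.injective ((hb.trans (by rw [ha, add_zero])).trans (hper (a.val + 1)).symm)
      omega
    · have := f.1.injective (ha.trans hb.symm)
      omega
  exact ⟨Equiv.ofBijective s (Finite.injective_iff_bijective.1 hinj), hs⟩

theorem exists_fPerm_eq {n : ℕ} [NeZero n] (f : AffinePerm (2 * n)) (hf : f ∈ Bd n (2 * n))
    (hsymm : ∀ a : ℤ, 1 ≤ a → a ≤ 2 * (n : ℤ) →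
      f.1 (2 * (n : ℤ) + 1 - a) = 4 * (n : ℤ) + 1 - f.1 a) :
    ∃ u w : weylC n, PBruhatLE (simpleC n) (parabolicC n) u w ∧
      fPerm n (2 * n) u.1 w.1 = f := by
  obtain ⟨s, hs⟩ := exists_perm_of_bounded f hf.2
  have hrev : ∀ r : Fin (2 * n), f.1 (r.rev.val + 1 : ℤ) = 4 * n + 1 - f.1 (r.val + 1 : ℤ) := by
    intro r
    have h := r.isLt
    rw [← hsymm _ (by omega) (by omega)]
    congr 1
    rw [Fin.val_rev]
    omega
  -- Values at mirror letters add up to `4n + 1`, so exactly one of them exceeds `2n`; removing that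
  -- single shift leaves residues adding up to `2n + 1`.
  have hsC : s ∈ weylC n := by
    intro r
    have h1 := hs r
    have h2 := hs r.rev
    have h3 := hrev r
    have h4 := (s r).isLt
    have h5 := (s r.rev).isLt
    rw [Fin.ext_iff, Fin.val_rev]
    split_ifs at h1 h2 <;> omega
  let I := Finset.univ.filter fun r : Fin (2 * n) => ((2 * n : ℕ) : ℤ) < f.1 (r.val + 1 : ℤ)
  have hI : ∀ r, r ∈ I ↔ ((2 * n : ℕ) : ℤ) < f.1 (r.val + 1 : ℤ) := fun r => by simp [I]
  obtain ⟨w, hw, hmono, hwI⟩ := exists_increasing_weylC I fun r => by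
    rw [hI, hI, hrev]
    omega
  have hsw : s * w ∈ weylC n := mul_mem hsC hw
  refine ⟨⟨s * w, hsw⟩, ⟨w, hw⟩, pBruhatLE_of_apply_le hmono _ fun c hc => ?_, ?_⟩
  · have h1 := hs (w c)
    rw [if_pos ((hI _).1 ((hwI c).2 hc))] at h1
    have h2 := (hf.2 ((w c).val + 1)).2
    change s (w c) ≤ w c
    rw [Fin.le_def]
    omega
  · refine AffinePerm.ext_of_residue fun r => ?_
    obtain ⟨c, rfl⟩ := w.surjective r
    rw [fPerm_apply, hs, Perm.mul_apply, if_congr ((hwI c).symm.trans (hI _)) rfl rfl]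

end BoundedAffine

theorem mainTheorem7 (n : ℕ) [NeZero n] :
    BoundedAffine.BdC n =
      {f : BoundedAffine.AffinePerm (2 * n) |
        f ∈ BoundedAffine.Bd n (2 * n) ∧
          ∀ a : ℤ, 1 ≤ a → a ≤ 2 * (n : ℤ) →
            f.1 (2 * (n : ℤ) + 1 - a) = 4 * (n : ℤ) + 1 - f.1 a} := by
  ext f
  constructor
  · rintro ⟨⟨⟨⟨u, w⟩, h⟩⟩, rfl⟩
    have hle : ∀ c : Fin (2 * n), c.val < n → u.1 c ≤ w.1 c := h.apply_le
    refine ⟨BoundedAffine.fPerm_mem_Bd hle fun c hc => ?_,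
      BoundedAffine.fPerm_symmetric u.2 w.2⟩
    -- The reversed inequality on the second half is the mirror image of the one on the first half.
    have h1 := hle c.rev (by rw [Fin.val_rev]; omega)
    rwa [u.2 c, w.2 c, Fin.rev_le_rev] at h1
  · rintro ⟨hf, hsymm⟩
    obtain ⟨u, w, h, rfl⟩ := BoundedAffine.exists_fPerm_eq f hf hsymm
    exact ⟨Quot.mk _ ⟨(u, w), h⟩, rfl⟩
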